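/- Convention: for sequences of rationals $(a_n)_{n\ge0}$, $(b_n)_{n\ge0}$ with $b_n\ne0$ for all $n$, the pair $(a_n,b_n)$ denotes the continued fraction $a_0+b_0/(a_1+b_1/(a_2+b_2/(a_3+\cdots)))$, with convergents $p_n/q_n=a_0+b_0/(a_1+\cdots+b_{n-1}/a_n)$; it converges to $z$ if $q_n\neq 0$ for all large $n$ and $p_n/q_n\to z$. A pair $(A,B)$ of polynomials with rational coefficients represents $z$ if there is such a continued fraction converging to $z$ with $a_n=A(n)$ and $b_n=B(n)$ for all sufficiently large $n$. Theorem (second four-parameter family for $\pi^2$). Let $v,w,k\ge0$ be integers and let $u$ be an integer, possibly negative, with $u\ge -k-\min(v,w)$. Put $$A(n)=8n^2+4(3u+v+w-4)n+4(k^2+u^2+uk+vk+wk+uv+uw+vw)+4k-10u-2v-2w+10,$$ $$B(n)=-(2n-1)(2n-1+2u)(2n-1+2u+2v)(2n-1+2u+2w).$$ Then: (i) $A(n)=4A_1(n-\tfrac12)$ and $B(n)=16B_1(n-\tfrac12)$ as polynomials, where $$A_1(n)=2n^2+(3u+v+w-2)n+k^2+u^2+uk+vk+wk+uv+uw+vw+k-u+1,$$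 $$B_1(n)=-n(n+u)(n+u+v)(n+u+w)$$ is the first four-parameter family. (ii) The pair $(A,B)$ represents $\pi^2$. (iii) For every continued fraction $(a_n,b_n)$ as above that converges to $\pi^2$ and satisfies $a_n=A(n)$ and $b_n=B(n)$ for all sufficiently large $n$, there is a nonzero real constant $C$ such that $$\pi^2-\frac{p_n}{q_n}\sim\frac{C}{n^{u+v+w+2k+1}}\qquad(n\to\infty).$$ -/

import Mathlib

open Filter Polynomial

/-- The continued fraction `a₀ + b₀ / (a₁ + b₁ / (a₂ + b₂ / (a₃ + ⋯)))`. -/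
def contFrac (a b : ℕ → ℚ) : GenContFract ℚ where
  h := a 0
  s := Stream'.Seq.ofStream fun n => ⟨b n, a (n + 1)⟩

/-- `contFrac a b` converges to `z`: the denominators `q n` of its convergents are eventually
nonzero and `p n / q n` tends to `z`. -/
def ContFracTendsTo (a b : ℕ → ℚ) (z : ℝ) : Prop :=
  (∀ᶠ n in atTop, (contFrac a b).dens n ≠ 0) ∧
    Tendsto (fun n => (((contFrac a b).nums n / (contFrac a b).dens n : ℚ) : ℝ)) atTop (nhds z)

/-- `contFrac a b` is a continued fraction with nonzero partial numerators, converging to `z`, and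
such that `a n = A n` and `b n = B n` for all sufficiently large `n`. -/
structure IsContFracFor (A B : ℚ[X]) (z : ℝ) (a b : ℕ → ℚ) : Prop where
  b_ne_zero : ∀ n, b n ≠ 0
  eventually_a : ∀ᶠ n in atTop, a n = A.eval (n : ℚ)
  eventually_b : ∀ᶠ n in atTop, b n = B.eval (n : ℚ)
  tendsTo : ContFracTendsTo a b z

/-- The pair of polynomials `(A, B)` represents the constant `z`. -/
def Represents (A B : ℚ[X]) (z : ℝ) : Prop :=
  ∃ a b : ℕ → ℚ, IsContFracFor A B z a b

noncomputable section

/-- The polynomial `A` of the first four-parameter family. -/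
def firstA (u v w k : ℚ) : ℚ[X] :=
  2 * X ^ 2 + C (3 * u + v + w - 2) * X
    + C (k ^ 2 + u ^ 2 + u * k + v * k + w * k + u * v + u * w + v * w + k - u + 1)

/-- The polynomial `B` of the first four-parameter family. -/
def firstB (u v w : ℚ) : ℚ[X] :=
  -(X * (X + C u) * (X + C (u + v)) * (X + C (u + w)))

/-- The polynomial `A` of the second four-parameter family. -/
def secondA (u v w k : ℚ) : ℚ[X] :=
  8 * X ^ 2 + C (4 * (3 * u + v + w - 4)) * X
    + C (4 * (k ^ 2 + u ^ 2 + u * k + v * k + w * k + u * v + u * w + v * w)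
        + 4 * k - 10 * u - 2 * v - 2 * w + 10)

/-- The polynomial `B` of the second four-parameter family. -/
def secondB (u v w : ℚ) : ℚ[X] :=
  -((2 * X - 1) * (2 * X - 1 + C (2 * u)) * (2 * X - 1 + C (2 * u + 2 * v))
    * (2 * X - 1 + C (2 * u + 2 * w)))

end

/-! Dividing a solution of the recurrence of `(A, B)` by `gammaFactor`, a product of half-integers,
turns the recurrence into the second order equation `HahnRec`, with eigenvalue `k * (k + u + v + w +
1)`. This equation is solved by induction on `k`.

For `k = 0` it is of first order in the differences. One solution is the constant 1; another has as
its differences the reciprocals of products of half-integers (`gammaQuot`). Partial fractions show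
that these reciprocals sum to a rational number plus `y * π ^ 2`. Only double poles contribute to
`y`, and their coefficients all have the same sign because residues alternate, so `y ≠ 0`.
Subtracting the rational part and dividing by `y` gives a solution tending to `π ^ 2`, with a tail
of known order.

For larger `k`, differencing takes solutions for `(v, w, k)` to solutions for `(v + 1, w + 1, k -
1)`, and `hahnRaise` inverts it rationally. Each inversion raises both exponents of growth by one
(Stolz–Cesàro), so `Q` has exact order `n ^ k` and `P - π ^ 2 * Q` exact order `n ^ (-(k + u + v + w
+ 1))`. Their quotient gives the claimed rate (`exists_hahnRec_tendsto`).

Finally, numerators and denominators of any continued fraction with this tail are combinations of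
`Q` and `P - π ^ 2 * Q`; convergence to `π ^ 2` fixes the dominant coefficients up to scale, and the
rate carries over (`represents_and_isEquivalent`). -/

/-! ### Convergents of continued fractions -/

theorem contFrac_nums_zero (a b : ℕ → ℚ) : (contFrac a b).nums 0 = a 0 := by
  simp [contFrac]

theorem contFrac_dens_zero (a b : ℕ → ℚ) : (contFrac a b).dens 0 = 1 := by
  simp

theorem contFrac_s_get? (a b : ℕ → ℚ) (n : ℕ) :
    (contFrac a b).s.get? n = some ⟨b n, a (n + 1)⟩ := rfl

theorem contFrac_nums_one (a b : ℕ → ℚ) : (contFrac a b).nums 1 = a 1 * a 0 + b 0 := by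
  rw [GenContFract.first_num_eq (contFrac_s_get? a b 0)]
  simp [contFrac]

theorem contFrac_dens_one (a b : ℕ → ℚ) : (contFrac a b).dens 1 = a 1 := by
  rw [GenContFract.first_den_eq (contFrac_s_get? a b 0)]

theorem contFrac_nums_add_two (a b : ℕ → ℚ) (n : ℕ) :
    (contFrac a b).nums (n + 2)
      = a (n + 2) * (contFrac a b).nums (n + 1) + b (n + 1) * (contFrac a b).nums n :=
  GenContFract.nums_recurrence (contFrac_s_get? a b (n + 1)) rfl rfl

theorem contFrac_dens_add_two (a b : ℕ → ℚ) (n : ℕ) :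
    (contFrac a b).dens (n + 2)
      = a (n + 2) * (contFrac a b).dens (n + 1) + b (n + 1) * (contFrac a b).dens n :=
  GenContFract.dens_recurrence (contFrac_s_get? a b (n + 1)) rfl rfl

/-- The determinant starts at `b 0` and is multiplied by `-b (n + 1)` at each step. -/
theorem contFrac_determinant_ne_zero (a b : ℕ → ℚ) (hb : ∀ n, b n ≠ 0) (n : ℕ) :
    (contFrac a b).nums (n + 1) * (contFrac a b).dens n
      - (contFrac a b).nums n * (contFrac a b).dens (n + 1) ≠ 0 := by
  induction n with
  | zero =>
    simp only [zero_add, contFrac_nums_one, contFrac_dens_one, contFrac_nums_zero,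
      contFrac_dens_zero]
    have := hb 0
    intro h
    apply this
    linear_combination h
  | succ n ih =>
    rw [contFrac_nums_add_two, contFrac_dens_add_two]
    intro h
    have := mul_ne_zero (hb (n + 1)) ih
    apply this
    linear_combination -h

/-- Two consecutive convergents of a continued fraction with nonzero partial numerators can be
prescribed, up to the obvious nondegeneracy condition. -/
theorem exists_contFrac_start (p₁ q₁ p₂ q₂ : ℚ) (h : p₁ * q₂ - p₂ * q₁ ≠ 0) :
    ∃ a₀ a₁ a₂ b₀ b₁ : ℚ, b₀ ≠ 0 ∧ b₁ ≠ 0 ∧ a₁ * a₀ + b₀ = p₁ ∧ a₁ = q₁ ∧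
      a₂ * p₁ + b₁ * a₀ = p₂ ∧ a₂ * q₁ + b₁ = q₂ := by
  -- `a₀` is a free parameter; it only has to make `b₀ = p₁ - a₀ * q₁` nonzero.
  obtain ⟨a₀, ha⟩ : ∃ a₀ : ℚ, p₁ - a₀ * q₁ ≠ 0 := by
    by_cases hp : p₁ = 0
    · refine ⟨1, fun h' => h ?_⟩
      rw [hp] at h' ⊢
      have : q₁ = 0 := by linarith
      simp [this]
    · exact ⟨0, by simpa using hp⟩
  refine ⟨a₀, q₁, (p₂ - a₀ * q₂) / (p₁ - a₀ * q₁), p₁ - a₀ * q₁,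
    (p₁ * q₂ - p₂ * q₁) / (p₁ - a₀ * q₁), ha, div_ne_zero h ha, by ring, rfl, ?_, ?_⟩
  · field_simp
    ring
  · field_simp
    ring

/-! ### Linear recurrences and transfer of the rate of convergence -/

/-- A solution of a second order linear recurrence vanishes if it does so at two consecutive
places. -/
theorem eq_zero_of_recurrence {K : Type*} [Field K] {α β y : ℕ → K} {N : ℕ}
    (hy : ∀ n ≥ N, y (n + 2) = α n * y (n + 1) + β n * y n)
    (h0 : y N = 0) (h1 : y (N + 1) = 0) : ∀ n ≥ N, y n = 0 ∧ y (n + 1) = 0 := by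
  intro n hn
  induction n, hn using Nat.le_induction with
  | base => exact ⟨h0, h1⟩
  | succ n hn ih => exact ⟨ih.2, by rw [hy n hn, ih.1, ih.2]; ring⟩

/-- Two solutions of a second order linear recurrence with nonzero Casoratian span all
solutions. -/
theorem exists_combination_of_recurrence {K : Type*} [Field K] {α β d r y : ℕ → K} {N : ℕ}
    (hd : ∀ n ≥ N, d (n + 2) = α n * d (n + 1) + β n * d n)
    (hr : ∀ n ≥ N, r (n + 2) = α n * r (n + 1) + β n * r n)
    (hy : ∀ n ≥ N, y (n + 2) = α n * y (n + 1) + β n * y n)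
    (hW : d N * r (N + 1) - d (N + 1) * r N ≠ 0) :
    ∃ c e : K, ∀ n ≥ N, y n = c * d n + e * r n := by
  refine ⟨(y N * r (N + 1) - y (N + 1) * r N) / (d N * r (N + 1) - d (N + 1) * r N),
    (d N * y (N + 1) - d (N + 1) * y N) / (d N * r (N + 1) - d (N + 1) * r N), fun n hn => ?_⟩
  set W := d N * r (N + 1) - d (N + 1) * r N with hWdef
  set c := (y N * r (N + 1) - y (N + 1) * r N) / W
  set e := (d N * y (N + 1) - d (N + 1) * y N) / W
  have hc : c * W = y N * r (N + 1) - y (N + 1) * r N := div_mul_cancel₀ _ hW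
  have he : e * W = d N * y (N + 1) - d (N + 1) * y N := div_mul_cancel₀ _ hW
  have key := eq_zero_of_recurrence (α := α) (β := β) (N := N)
    (y := fun n => y n - (c * d n + e * r n)) ?_ ?_ ?_ n hn
  · exact sub_eq_zero.1 key.1
  · intro m hm
    simp only [hd m hm, hr m hm, hy m hm]
    ring
  · refine mul_right_cancel₀ hW ?_
    linear_combination y N * hWdef - d N * hc - r N * he
  · refine mul_right_cancel₀ hW ?_
    linear_combination y (N + 1) * hWdef - d (N + 1) * hc - r (N + 1) * he

theorem tendsto_natCast_zpow_atTop {e : ℤ} (he : 0 < e) :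
    Tendsto (fun n : ℕ => (n : ℝ) ^ e) atTop atTop := by
  lift e to ℕ using he.le
  simp only [zpow_natCast]
  exact (tendsto_pow_atTop (by omega)).comp tendsto_natCast_atTop_atTop

/-- If `P n / Q n` tends to `z` at a polynomial rate along two solutions `P`, `Q` of the recurrence
of a polynomial continued fraction, then the continued fraction represents `z`, and all continued
fractions with the same tail converging to `z` do so at the same rate. -/
theorem represents_and_isEquivalent {A B : ℚ[X]} {z : ℝ} {P Q : ℕ → ℚ} {e : ℤ} (he : 0 < e) {c : ℝ}
    (hc : c ≠ 0) (hB : ∀ n : ℕ, B.eval (n : ℚ) ≠ 0)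
    (hP : ∀ n : ℕ, P (n + 2) = A.eval ((n + 2 : ℕ) : ℚ) * P (n + 1)
      + B.eval ((n + 1 : ℕ) : ℚ) * P n)
    (hQ : ∀ n : ℕ, Q (n + 2) = A.eval ((n + 2 : ℕ) : ℚ) * Q (n + 1)
      + B.eval ((n + 1 : ℕ) : ℚ) * Q n)
    (hQ0 : ∀ᶠ n in atTop, Q n ≠ 0)
    (hlim : Tendsto (fun n : ℕ => ((P n : ℝ) - z * Q n) / Q n * (n : ℝ) ^ e) atTop (nhds c)) :
    Represents A B z ∧ ∀ a b : ℕ → ℚ, IsContFracFor A B z a b →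
      ∃ c : ℝ, c ≠ 0 ∧ Asymptotics.IsEquivalent atTop
        (fun n : ℕ => z - (((contFrac a b).nums n / (contFrac a b).dens n : ℚ) : ℝ))
        (fun n : ℕ => c / (n : ℝ) ^ e) := by
  have hpow := tendsto_natCast_zpow_atTop he
  have hρ : Tendsto (fun n : ℕ => ((P n : ℝ) - z * Q n) / Q n) atTop (nhds 0) := by
    have h := hlim.mul hpow.inv_tendsto_atTop
    rw [mul_zero] at h
    refine h.congr' ?_
    filter_upwards [eventually_gt_atTop 0] with n hn
    have : (n : ℝ) ^ e ≠ 0 := zpow_ne_zero _ (by positivity)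
    simp only [Pi.inv_apply]
    field_simp
  have hρ0 : ∀ᶠ n : ℕ in atTop, (P n : ℝ) - z * Q n ≠ 0 := by
    filter_upwards [hlim.eventually_ne hc] with n hn h
    simp [h] at hn
  -- If the Casoratian vanished once, it would vanish from there on, so `(P - z * Q) / Q` would be
  -- eventually constant. Its limit is 0, yet it is eventually nonzero.
  have hW : ∀ n, P (n + 1) * Q (n + 2) - P (n + 2) * Q (n + 1) ≠ 0 := by
    intro n h
    have hzero : ∀ m ≥ n + 1, P m * Q (m + 1) - P (m + 1) * Q m = 0 := by
      intro m hm
      induction m, hm using Nat.le_induction with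
      | base => exact h
      | succ m hm ih =>
        rw [hP m, hQ m]
        linear_combination -(B.eval ((m + 1 : ℕ) : ℚ)) * ih
    obtain ⟨N, hN⟩ := eventually_atTop.1 (hQ0.and hρ0)
    have hconst : ∀ m ≥ max N (n + 1), ((P m : ℝ) - z * Q m) / Q m
        = ((P (max N (n + 1)) : ℝ) - z * Q (max N (n + 1))) / Q (max N (n + 1)) := by
      intro m hm
      induction m, hm using Nat.le_induction with
      | base => rfl
      | succ m hm ih =>
        rw [← ih]
        have h1 : (Q m : ℝ) ≠ 0 := by
          exact_mod_cast (hN m (le_trans (le_max_left _ _) hm)).1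
        have h2 : (Q (m + 1) : ℝ) ≠ 0 := by
          exact_mod_cast (hN (m + 1) (by omega)).1
        have h3 : (P m : ℝ) * Q (m + 1) - P (m + 1) * Q m = 0 := by
          exact_mod_cast hzero m (le_trans (le_max_right _ _) hm)
        rw [div_eq_div_iff h2 h1]
        linear_combination -h3
    have hl := tendsto_nhds_unique hρ (tendsto_const_nhds.congr'
      (by filter_upwards [eventually_ge_atTop (max N (n + 1))] with m hm using (hconst m hm).symm))
    have h4 := hN (max N (n + 1)) (le_max_left _ _)
    rw [eq_comm, div_eq_zero_iff] at hl
    rcases hl with hl | hl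
    · exact h4.2 hl
    · exact h4.1 (by exact_mod_cast hl)
  refine ⟨?_, ?_⟩
  -- The convergents are matched with `P`, `Q` from index 1 on, since the denominator at index 0 is
  -- always 1.
  · obtain ⟨a₀, a₁, a₂, b₀, b₁, hb₀, hb₁, h1, h2, h3, h4⟩ :=
      exists_contFrac_start _ _ _ _ (hW 0)
    let a : ℕ → ℚ := fun n =>
      if n = 0 then a₀ else if n = 1 then a₁ else if n = 2 then a₂ else A.eval (n : ℚ)
    let b : ℕ → ℚ := fun n => if n = 0 then b₀ else if n = 1 then b₁ else B.eval (n : ℚ)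
    have hpq : ∀ n, ((contFrac a b).nums (n + 1) = P (n + 1) ∧
        (contFrac a b).nums (n + 2) = P (n + 2)) ∧
        ((contFrac a b).dens (n + 1) = Q (n + 1) ∧ (contFrac a b).dens (n + 2) = Q (n + 2)) := by
      intro n
      induction n with
      | zero =>
        rw [contFrac_nums_add_two, contFrac_dens_add_two, zero_add, contFrac_nums_one,
          contFrac_dens_one, contFrac_nums_zero, contFrac_dens_zero]
        simp only [a, b]
        norm_num
        norm_num at h1 h2 h3 h4
        subst h2
        exact ⟨⟨h1, by rw [← h3, ← h1]⟩, rfl, h4⟩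
      | succ n ih =>
        refine ⟨⟨ih.1.2, ?_⟩, ih.2.2, ?_⟩
        · rw [contFrac_nums_add_two, ih.1.1, ih.1.2, hP (n + 1)]
          simp [a, b]
        · rw [contFrac_dens_add_two, ih.2.1, ih.2.2, hQ (n + 1)]
          simp [a, b]
    have hn : ∀ n > 0, (contFrac a b).nums n = P n ∧ (contFrac a b).dens n = Q n := by
      intro n hn
      obtain ⟨m, rfl⟩ := Nat.exists_eq_add_of_le' hn
      exact ⟨(hpq m).1.1, (hpq m).2.1⟩
    refine ⟨a, b, ?_, ?_, ?_, ?_, ?_⟩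
    · intro n
      simp only [b]
      split_ifs
      exacts [hb₀, hb₁, hB n]
    · filter_upwards [eventually_gt_atTop 2] with n hn
      simp only [a]
      rw [if_neg (by omega), if_neg (by omega), if_neg (by omega)]
    · filter_upwards [eventually_gt_atTop 1] with n hn
      simp only [b]
      rw [if_neg (by omega), if_neg (by omega)]
    · filter_upwards [eventually_gt_atTop 0, hQ0] with n h0 hq
      rwa [(hn n h0).2]
    · have h := hρ.add_const z
      rw [zero_add] at h
      refine h.congr' ?_
      filter_upwards [eventually_gt_atTop 0, hQ0] with n h0 hq
      rw [(hn n h0).1, (hn n h0).2]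
      have : (Q n : ℝ) ≠ 0 := by exact_mod_cast hq
      push_cast
      field_simp
      ring
  · intro a b hab
    obtain ⟨N, hN⟩ := eventually_atTop.1 (hab.eventually_a.and hab.eventually_b)
    set p := (contFrac a b).nums with hp
    set q := (contFrac a b).dens with hq
    have hW' : (Q (N + 1) : ℝ) * (P (N + 1 + 1) - z * Q (N + 1 + 1))
        - Q (N + 1 + 1) * (P (N + 1) - z * Q (N + 1)) ≠ 0 := by
      intro h
      apply hW N
      have : (P (N + 1) : ℝ) * Q (N + 2) - P (N + 2) * Q (N + 1) = 0 := by
        linear_combination -h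
      exact_mod_cast this
    have hrec : ∀ {y : ℕ → ℚ}, (∀ n, y (n + 2) = a (n + 2) * y (n + 1) + b (n + 1) * y n) →
        ∃ c e : ℝ, ∀ n ≥ N + 1, (y n : ℝ) = c * Q n + e * (P n - z * Q n) := by
      intro y hy
      refine exists_combination_of_recurrence (d := fun n => (Q n : ℝ))
        (r := fun n => (P n : ℝ) - z * Q n) (y := fun n => (y n : ℝ))
        (α := fun n => ((A.eval ((n + 2 : ℕ) : ℚ) : ℚ) : ℝ))
        (β := fun n => ((B.eval ((n + 1 : ℕ) : ℚ) : ℚ) : ℝ)) ?_ ?_ ?_ hW'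
      · intro n _
        simp only [hQ n]
        push_cast
        ring
      · intro n _
        simp only [hQ n, hP n]
        push_cast
        ring
      · intro n hn
        simp only [hy n, (hN (n + 2) (by omega)).1, (hN (n + 1) (by omega)).2]
        push_cast
        ring
    obtain ⟨c₁, c₂, hpc⟩ := hrec (contFrac_nums_add_two a b)
    obtain ⟨c₃, c₄, hqc⟩ := hrec (contFrac_dens_add_two a b)
    rw [← hp] at hpc
    rw [← hq] at hqc
    have hdet : c₁ * c₄ - c₂ * c₃ ≠ 0 := by
      intro h
      have h1 := contFrac_determinant_ne_zero a b hab.b_ne_zero (N + 1)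
      rw [← hp, ← hq] at h1
      apply h1
      have : (p (N + 1 + 1) : ℝ) * q (N + 1) - p (N + 1) * q (N + 1 + 1) = 0 := by
        rw [hpc _ le_rfl, hqc _ le_rfl, hpc _ (Nat.le_succ _), hqc _ (Nat.le_succ _)]
        linear_combination h * (Q (N + 1 + 1) * (P (N + 1) - z * Q (N + 1))
          - Q (N + 1) * (P (N + 1 + 1) - z * Q (N + 1 + 1)))
      exact_mod_cast this
    obtain ⟨hq0, hpq⟩ := hab.tendsTo
    -- both convergents, relative to the dominant solution
    have hpl : Tendsto (fun n => (p n : ℝ) / Q n) atTop (nhds c₁) := by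
      have h := (hρ.const_mul c₂).const_add c₁
      rw [mul_zero, add_zero] at h
      refine h.congr' ?_
      filter_upwards [hQ0, eventually_ge_atTop (N + 1)] with n h0 hn
      have : (Q n : ℝ) ≠ 0 := by exact_mod_cast h0
      rw [hpc n hn]
      field_simp
    have hql : Tendsto (fun n => (q n : ℝ) / Q n) atTop (nhds c₃) := by
      have h := (hρ.const_mul c₄).const_add c₃
      rw [mul_zero, add_zero] at h
      refine h.congr' ?_
      filter_upwards [hQ0, eventually_ge_atTop (N + 1)] with n h0 hn
      have : (Q n : ℝ) ≠ 0 := by exact_mod_cast h0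
      rw [hqc n hn]
      field_simp
    -- `p / Q → c₁`, `q / Q → c₃` and `p / q → z`. With the determinant this gives `c₃ ≠ 0`, and `z
    -- * q - p` is a nonzero multiple of `P - z * Q`.
    have hc₁ : c₁ = z * c₃ := by
      refine tendsto_nhds_unique hpl ((hpq.mul hql).congr' ?_)
      filter_upwards [hQ0, hq0] with n h0 h1
      have h0' : (Q n : ℝ) ≠ 0 := by exact_mod_cast h0
      have h1' : (q n : ℝ) ≠ 0 := by exact_mod_cast h1
      push_cast
      rw [← hp, ← hq]
      field_simp
    have hc₃ : c₃ ≠ 0 := by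
      intro h
      rw [hc₁, h] at hdet
      simp at hdet
    have hc₂ : z * c₄ - c₂ ≠ 0 := by
      intro h
      apply hdet
      rw [hc₁]
      linear_combination c₃ * h
    refine ⟨(z * c₄ - c₂) * c / c₃, div_ne_zero (mul_ne_zero hc₂ hc) hc₃, ?_⟩
    have hC : (z * c₄ - c₂) * c / c₃ ≠ 0 := div_ne_zero (mul_ne_zero hc₂ hc) hc₃
    refine Asymptotics.isEquivalent_of_tendsto_one ?_
    have h := ((hlim.const_mul (z * c₄ - c₂)).div hql hc₃).div_const ((z * c₄ - c₂) * c / c₃)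
    rw [div_self hC] at h
    refine h.congr' ?_
    filter_upwards [hQ0, hq0, eventually_gt_atTop N] with n h0 h1 hn
    have h0' : (Q n : ℝ) ≠ 0 := by exact_mod_cast h0
    have h1' : (q n : ℝ) ≠ 0 := by exact_mod_cast h1
    have hn0 : (n : ℝ) ^ e ≠ 0 :=
      zpow_ne_zero _ (by exact_mod_cast (Nat.zero_lt_of_lt hn).ne')
    have h2 : z - ((p n / q n : ℚ) : ℝ) = (z * c₄ - c₂) * (P n - z * Q n) / q n := by
      push_cast
      field_simp
      rw [hpc n hn, hqc n hn, hc₁]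
      ring
    simp only [Pi.div_apply]
    rw [h2]
    field_simp

/-! ### Stolz–Cesàro for integral powers -/

/-- `((n + 1) ^ p - n ^ p) / n ^ (p - 1)` tends to `p`. -/
theorem tendsto_zpow_succ_sub_div (p : ℤ) :
    Tendsto (fun n : ℕ => (((n + 1 : ℕ) : ℝ) ^ p - (n : ℝ) ^ p) / (n : ℝ) ^ (p - 1))
      atTop (nhds p) := by
  -- The quotient is the slope of `x ^ p` at 1 with increment `1 / n`.
  have h := (hasDerivAt_zpow p (1 : ℝ) (Or.inl one_ne_zero)).tendsto_slope_zero
  have h1 : Tendsto (fun n : ℕ => ((n : ℝ))⁻¹) atTop (nhdsWithin 0 {0}ᶜ) := by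
    refine tendsto_nhdsWithin_iff.2 ⟨tendsto_inv_atTop_nhds_zero_nat, ?_⟩
    filter_upwards [eventually_gt_atTop 0] with n hn
    have : (n : ℝ) ≠ 0 := by positivity
    simpa using hn.ne'
  have h2 := h.comp h1
  simp only [one_zpow, mul_one] at h2
  refine h2.congr' ?_
  filter_upwards [eventually_gt_atTop 0] with n hn
  have hn' : (n : ℝ) ≠ 0 := by positivity
  have : (1 : ℝ) + (n : ℝ)⁻¹ = ((n + 1 : ℕ) : ℝ) / n := by
    push_cast
    field_simp
  simp only [Function.comp, smul_eq_mul, inv_inv]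
  rw [this, div_zpow, zpow_sub_one₀ hn']
  have : (n : ℝ) ^ p ≠ 0 := zpow_ne_zero _ hn'
  field_simp

/-- A sequence tending to zero whose increments are small compared with those of a decreasing
sequence tending to zero is small compared with the latter. -/
theorem abs_le_of_abs_sub_le {f b : ℕ → ℝ} {ε : ℝ} {N : ℕ} (hf : Tendsto f atTop (nhds 0))
    (hb : Tendsto b atTop (nhds 0)) (h : ∀ n ≥ N, |f (n + 1) - f n| ≤ ε * (b n - b (n + 1))) :
    ∀ n ≥ N, |f n| ≤ ε * b n := by
  intro n hn
  have key : ∀ m ≥ n, |f n - f m| ≤ ε * (b n - b m) := by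
    intro m hm
    induction m, hm using Nat.le_induction with
    | base => simp
    | succ m hm ih =>
      have h1 := h m (hn.trans hm)
      have h2 := abs_sub_le (f n) (f m) (f (m + 1))
      rw [abs_sub_comm (f m)] at h2
      linarith
  have h1 : Tendsto (fun m => |f n - f m|) atTop (nhds |f n - 0|) := (hf.const_sub _).abs
  have h2 : Tendsto (fun m => ε * (b n - b m)) atTop (nhds (ε * (b n - 0))) :=
    (hb.const_sub _).const_mul _
  simpa using le_of_tendsto_of_tendsto h1 h2 (eventually_atTop.2 ⟨n, key⟩)

/-- Stolz–Cesàro for comparison with an integral power of `n`. -/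
theorem tendsto_div_zpow_of_tendsto_sub_div {p : ℤ} (hp : p ≠ 0) {r : ℕ → ℝ} {c : ℝ}
    (hr : p < 0 → Tendsto r atTop (nhds 0))
    (h : Tendsto (fun n : ℕ => (r (n + 1) - r n) / (n : ℝ) ^ (p - 1)) atTop (nhds c)) :
    Tendsto (fun n : ℕ => r n / (n : ℝ) ^ p) atTop (nhds (c / p)) := by
  have hp' : (p : ℝ) ≠ 0 := by exact_mod_cast hp
  set f : ℕ → ℝ := fun n => r n - c / p * (n : ℝ) ^ p with hf
  have hd : Tendsto (fun n : ℕ => (f (n + 1) - f n) /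
      (((n + 1 : ℕ) : ℝ) ^ p - (n : ℝ) ^ p)) atTop (nhds 0) := by
    have h1 := (h.sub ((tendsto_zpow_succ_sub_div p).const_mul (c / p))).div
      (tendsto_zpow_succ_sub_div p) hp'
    have h2 : (c - c / p * p) / (p : ℝ) = 0 := by
      field_simp
      ring
    rw [h2] at h1
    refine h1.congr' ?_
    filter_upwards [eventually_gt_atTop 0] with n hn
    have hn' : (n : ℝ) ^ (p - 1) ≠ 0 := zpow_ne_zero _ (by positivity)
    simp only [Pi.div_apply, hf]
    rw [← mul_div_assoc, ← sub_div, div_div_div_cancel_right₀ hn']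
    congr 1
    ring
  have hne : ∀ᶠ n : ℕ in atTop, ((n + 1 : ℕ) : ℝ) ^ p - (n : ℝ) ^ p ≠ 0 := by
    filter_upwards [(tendsto_zpow_succ_sub_div p).eventually_ne hp'] with n hn h
    rw [h, zero_div] at hn
    exact hn rfl
  have hmain : Tendsto (fun n : ℕ => f n / (n : ℝ) ^ p) atTop (nhds 0) := by
    rcases lt_or_gt_of_ne hp with hneg | hpos
    -- For negative `p` the increments are summed from `n` to infinity, which is where `r → 0`
    -- enters; for positive `p` they are summed from 0.
    · have hpow : Tendsto (fun n : ℕ => (n : ℝ) ^ p) atTop (nhds 0) := by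
        have := (tendsto_natCast_zpow_atTop (neg_pos.2 hneg)).inv_tendsto_atTop
        refine this.congr fun n => ?_
        simp
      have hf0 : Tendsto f atTop (nhds 0) := by
        simpa using (hr hneg).sub (hpow.const_mul (c / p))
      rw [Metric.tendsto_atTop]
      intro ε hε
      obtain ⟨N, hN⟩ := eventually_atTop.1
        ((Metric.tendsto_nhds.1 hd (ε / 2) (by positivity)).and hne)
      have hle : ∀ n ≥ N + 1, |f (n + 1) - f n|
          ≤ ε / 2 * ((n : ℝ) ^ p - ((n + 1 : ℕ) : ℝ) ^ p) := by
        intro n hn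
        obtain ⟨h1, h2⟩ := hN n (by omega)
        have hanti : ((n + 1 : ℕ) : ℝ) ^ p ≤ (n : ℝ) ^ p := by
          have hn0 : 0 < (n : ℝ) := by exact_mod_cast (by omega : 0 < n)
          have := zpow_le_zpow_left₀ (n := -p) (by omega) hn0.le
            (by simp : (n : ℝ) ≤ ((n + 1 : ℕ) : ℝ))
          rw [zpow_neg, zpow_neg] at this
          exact (inv_le_inv₀ (by positivity) (by positivity)).1 this
        rw [Real.dist_eq, sub_zero, abs_div, div_lt_iff₀ (abs_pos.2 h2),
          abs_of_nonpos (a := ((n + 1 : ℕ) : ℝ) ^ p - (n : ℝ) ^ p) (by linarith)] at h1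
        linarith
      refine ⟨N + 1, fun n hn => ?_⟩
      have h1 := abs_le_of_abs_sub_le hf0 hpow hle n hn
      have h2 : 0 < (n : ℝ) ^ p :=
        zpow_pos (by exact_mod_cast (by omega : 0 < n)) _
      rw [Real.dist_eq, sub_zero, abs_div, div_lt_iff₀ (abs_pos.2 h2.ne'), abs_of_pos h2]
      nlinarith
    · lift p to ℕ using hpos.le
      simp only [zpow_natCast] at hd hne ⊢
      have hp0 : 0 < p := by exact_mod_cast hpos
      have hatTop : Tendsto (fun n : ℕ => (n : ℝ) ^ p) atTop atTop :=
        (tendsto_pow_atTop (by omega)).comp tendsto_natCast_atTop_atTop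
      have ho : (fun n : ℕ => f (n + 1) - f n) =o[atTop]
          (fun n : ℕ => ((n + 1 : ℕ) : ℝ) ^ p - (n : ℝ) ^ p) :=
        (Asymptotics.isLittleO_iff_tendsto' (by
          filter_upwards [hne] with n hn h0 using absurd h0 hn)).2 hd
      have hsum : ∀ n : ℕ, ∑ i ∈ Finset.range n, (((i + 1 : ℕ) : ℝ) ^ p - (i : ℝ) ^ p)
          = (n : ℝ) ^ p := by
        intro n
        rw [Finset.sum_range_sub (fun i : ℕ => (i : ℝ) ^ p)]
        simp [hp0.ne']
      have hs := ho.sum_range (fun n => sub_nonneg.2 (by gcongr; simp)) (by simpa only [hsum])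
      simp only [hsum, Finset.sum_range_sub] at hs
      have h0 : (fun _ : ℕ => f 0) =o[atTop] fun n : ℕ => (n : ℝ) ^ p :=
        Asymptotics.isLittleO_const_left.2 (Or.inr (tendsto_norm_atTop_atTop.comp hatTop))
      have := (hs.add h0).tendsto_div_nhds_zero
      simpa using this
  have := hmain.add_const (c / p)
  rw [zero_add] at this
  refine this.congr' ?_
  filter_upwards [eventually_gt_atTop 0] with n hn
  have hn' : (n : ℝ) ^ p ≠ 0 := zpow_ne_zero _ (by positivity)
  simp only [hf]
  rw [sub_div, mul_div_assoc, div_self hn']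
  ring

/-! ### Series with sums in `ℚ + ℚ * π ^ 2` -/

/-- The series `∑ f i` of rationals converges to a rational number plus `y * π ^ 2`. -/
def PiSqSum (f : ℕ → ℚ) (y : ℚ) : Prop :=
  ∃ q : ℚ, Tendsto (fun n => ((∑ i ∈ Finset.range n, f i : ℚ) : ℝ)) atTop
    (nhds (q + y * Real.pi ^ 2))

theorem PiSqSum.add {f g : ℕ → ℚ} {x y : ℚ} (hf : PiSqSum f x) (hg : PiSqSum g y) :
    PiSqSum (fun i => f i + g i) (x + y) := by
  obtain ⟨p, hp⟩ := hf
  obtain ⟨q, hq⟩ := hg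
  refine ⟨p + q, ?_⟩
  convert hp.add hq using 2
  · rw [Finset.sum_add_distrib]
    push_cast
    ring
  · push_cast
    ring

theorem PiSqSum.const_mul {f : ℕ → ℚ} {x : ℚ} (c : ℚ) (hf : PiSqSum f x) :
    PiSqSum (fun i => c * f i) (c * x) := by
  obtain ⟨p, hp⟩ := hf
  refine ⟨c * p, ?_⟩
  convert hp.const_mul (c : ℝ) using 2
  · rw [← Finset.mul_sum]
    push_cast
    ring
  · push_cast
    ring

theorem PiSqSum.zero : PiSqSum (fun _ => 0) 0 :=
  ⟨0, by simp⟩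

theorem PiSqSum.sum {ι : Type*} (s : Finset ι) {f : ι → ℕ → ℚ} {x : ι → ℚ}
    (h : ∀ j ∈ s, PiSqSum (f j) (x j)) :
    PiSqSum (fun i => ∑ j ∈ s, f j i) (∑ j ∈ s, x j) := by
  classical
  induction s using Finset.induction_on with
  | empty => simpa using PiSqSum.zero
  | insert j s hj ih =>
    simp only [Finset.sum_insert hj]
    exact (h j (by simp)).add (ih fun l hl => h l (by simp [hl]))

theorem piSqSum_succ_iff {f : ℕ → ℚ} {x : ℚ} :
    PiSqSum (fun i => f (i + 1)) x ↔ PiSqSum f x := by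
  constructor
  · rintro ⟨q, hq⟩
    refine ⟨q + f 0, (tendsto_add_atTop_iff_nat 1).1 ?_⟩
    convert hq.add_const (f 0 : ℝ) using 2
    · rw [Finset.sum_range_succ']
      push_cast
      ring
    · push_cast
      ring
  · rintro ⟨q, hq⟩
    refine ⟨q - f 0, ?_⟩
    convert ((tendsto_add_atTop_iff_nat 1).2 hq).sub_const (f 0 : ℝ) using 2
    · rw [Finset.sum_range_succ']
      push_cast
      ring
    · push_cast
      ring

theorem half_int_ne_zero (n : ℤ) : (n : ℚ) + 1 / 2 ≠ 0 := by
  intro h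
  have h1 : (2 * n + 1 : ℚ) = 0 := by linarith
  have h2 : (2 * n + 1 : ℤ) = 0 := by exact_mod_cast h1
  omega

theorem nat_add_half_add_int_ne_zero (m : ℕ) (i : ℤ) : (m : ℚ) + 1 / 2 + i ≠ 0 := by
  have := half_int_ne_zero (m + i)
  push_cast at this
  intro h
  apply this
  linarith

/-- `1 / (x + i) - 1 / (x + j)` telescopes to a rational number. -/
theorem piSqSum_inv_sub_inv (i j : ℤ) :
    PiSqSum (fun m : ℕ => ((m : ℚ) + 1 / 2 + i)⁻¹ - ((m : ℚ) + 1 / 2 + j)⁻¹) 0 := by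
  have step : ∀ i : ℤ,
      PiSqSum (fun m : ℕ => ((m : ℚ) + 1 / 2 + i)⁻¹ - ((m : ℚ) + 1 / 2 + (i + 1 : ℤ))⁻¹) 0 := by
    intro i
    refine ⟨((0 : ℚ) + 1 / 2 + i)⁻¹, ?_⟩
    have h1 : Tendsto (fun n : ℕ => ((n : ℝ) + (1 / 2 + i))⁻¹) atTop (nhds 0) :=
      (tendsto_atTop_add_const_right _ _ tendsto_natCast_atTop_atTop).inv_tendsto_atTop
    convert h1.const_sub ((((0 : ℚ) + 1 / 2 + i)⁻¹ : ℚ) : ℝ) using 2 with n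
    · have := Finset.sum_range_sub' (fun m : ℕ => ((m : ℚ) + 1 / 2 + i)⁻¹) n
      rw [← add_assoc]
      push_cast at this ⊢
      simp only [add_assoc, add_comm (1 : ℚ)] at this ⊢
      have h2 := congrArg (fun x : ℚ => (x : ℝ)) this
      push_cast at h2
      simp only [add_comm] at h2 ⊢
      linarith
    · simp
  have main : ∀ j : ℤ,
      PiSqSum (fun m : ℕ => ((m : ℚ) + 1 / 2 + (0 : ℤ))⁻¹ - ((m : ℚ) + 1 / 2 + j)⁻¹) 0 := by
    intro j
    induction j using Int.induction_on with
    | zero => simpa using PiSqSum.zero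
    | succ j ih => simpa using ih.add (step j)
    | pred j ih =>
      have := ih.add ((step (-j - 1)).const_mul (-1))
      simpa using this
  simpa using (main j).add ((main i).const_mul (-1))

/-- This is 4 times the odd part of `ζ(2)`, that is `4 * π ^ 2 / 8`. -/
theorem piSqSum_odd : PiSqSum (fun m : ℕ => ((m : ℚ) + 1 / 2)⁻¹ * ((m : ℚ) + 1 / 2)⁻¹) (1 / 2) := by
  refine ⟨0, ?_⟩
  have h := hasSum_zeta_two
  have heven : HasSum (fun n : ℕ => (1 : ℝ) / ((2 * n : ℕ) : ℝ) ^ 2) (Real.pi ^ 2 / 24) := by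
    have e : (fun n : ℕ => (1 : ℝ) / ((2 * n : ℕ) : ℝ) ^ 2)
        = fun n : ℕ => 1 / 4 * (1 / (n : ℝ) ^ 2) := by
      funext n
      push_cast
      ring
    rw [e, show Real.pi ^ 2 / 24 = 1 / 4 * (Real.pi ^ 2 / 6) by ring]
    exact h.mul_left _
  have hodd : Summable (fun n : ℕ => (1 : ℝ) / ((2 * n + 1 : ℕ) : ℝ) ^ 2) :=
    h.summable.comp_injective (i := fun n : ℕ => 2 * n + 1) fun a b hab => by
      simpa using hab
  have hs := (HasSum.even_add_odd (f := fun n : ℕ => (1 : ℝ) / (n : ℝ) ^ 2) heven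
    hodd.hasSum).unique h
  have hval : HasSum (fun n : ℕ => (1 : ℝ) / ((2 * n + 1 : ℕ) : ℝ) ^ 2) (Real.pi ^ 2 / 8) := by
    convert hodd.hasSum using 1
    linarith
  convert (hval.mul_left 4).tendsto_sum_nat using 2
  · push_cast
    refine Finset.sum_congr rfl fun m _ => ?_
    have h1 : (2 * (m : ℝ) + 1) ≠ 0 := by positivity
    have h2 : ((m : ℝ) + 1 / 2) ≠ 0 := by positivity
    field_simp
    ring
  · push_cast
    ring

theorem piSqSum_inv_sq (i : ℤ) :
    PiSqSum (fun m : ℕ => ((m : ℚ) + 1 / 2 + i)⁻¹ * ((m : ℚ) + 1 / 2 + i)⁻¹) (1 / 2) := by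
  have step : ∀ i : ℤ,
      PiSqSum (fun m : ℕ => ((m : ℚ) + 1 / 2 + (i + 1 : ℤ))⁻¹ * ((m : ℚ) + 1 / 2 + (i + 1 : ℤ))⁻¹)
        (1 / 2) ↔
      PiSqSum (fun m : ℕ => ((m : ℚ) + 1 / 2 + i)⁻¹ * ((m : ℚ) + 1 / 2 + i)⁻¹) (1 / 2) := by
    intro i
    rw [← piSqSum_succ_iff (f := fun m : ℕ =>
      ((m : ℚ) + 1 / 2 + i)⁻¹ * ((m : ℚ) + 1 / 2 + i)⁻¹)]
    have : ∀ m : ℕ, (m : ℚ) + 1 / 2 + (i + 1 : ℤ) = ((m + 1 : ℕ) : ℚ) + 1 / 2 + i := by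
      intro m
      push_cast
      ring
    simp only [this]
  induction i using Int.induction_on with
  | zero => simpa using piSqSum_odd
  | succ j ih => exact (step j).2 ih
  | pred j ih => exact (step (-j - 1)).1 (by simpa using ih)

theorem piSqSum_inv_mul_inv (i j : ℤ) :
    PiSqSum (fun m : ℕ => ((m : ℚ) + 1 / 2 + i)⁻¹ * ((m : ℚ) + 1 / 2 + j)⁻¹)
      (if i = j then 1 / 2 else 0) := by
  split_ifs with h
  · subst h
    exact piSqSum_inv_sq i
  · have hij : (j : ℚ) - i ≠ 0 := by
      rw [sub_ne_zero]
      exact_mod_cast Ne.symm h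
    have := (piSqSum_inv_sub_inv i j).const_mul ((j : ℚ) - i)⁻¹
    rw [mul_zero] at this
    convert this using 2 with m
    have h1 := nat_add_half_add_int_ne_zero m i
    have h2 := nat_add_half_add_int_ne_zero m j
    rw [inv_sub_inv h1 h2, ← mul_inv]
    field_simp
    ring

/-! ### Partial fractions and the coefficient of `π ^ 2` -/

/-- Partial fractions for `1 / (x (x + 1) ⋯ (x + N))`: the residues alternate in sign. -/
theorem exists_partialFractions (N : ℕ) :
    ∃ a : ℕ → ℚ, (∀ j ≤ N, 0 < (-1) ^ j * a j) ∧ (∀ j > N, a j = 0) ∧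
      ∀ x : ℚ, (∀ j : ℕ, x + j ≠ 0) →
        ∏ i ∈ Finset.range (N + 1), (x + i)⁻¹ = ∑ j ∈ Finset.range (N + 1), a j * (x + j)⁻¹ := by
  induction N with
  | zero =>
    refine ⟨fun j => if j = 0 then 1 else 0, ?_, ?_, ?_⟩
    · intro j hj
      simp [Nat.le_zero.1 hj]
    · intro j hj
      simp [hj.ne']
    · simp
  | succ N ih =>
    obtain ⟨a, hpos, hzero, hpf⟩ := ih
    have hN : (0 : ℚ) < N + 1 := by positivity
    -- Read off from `1 / (x)_{N+2} = (1 / (x)_{N+1} - 1 / (x+1)_{N+1}) / (N + 1)`. Neighbouring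
    -- residues have opposite signs, so the differences do not cancel.
    let a' : ℕ → ℚ := fun j => Nat.casesOn j (a 0 / (N + 1)) fun l => (a (l + 1) - a l) / (N + 1)
    have hsgn : ∀ j, 0 ≤ (-1) ^ j * a j := by
      intro j
      rcases le_or_gt j N with h | h
      · exact (hpos j h).le
      · simp [hzero j h]
    refine ⟨a', ?_, ?_, ?_⟩
    · rintro (_ | l) hl
      · have := hpos 0 (Nat.zero_le _)
        simp only [pow_zero, one_mul] at this
        rw [pow_zero, one_mul]
        exact div_pos this hN
      · have h1 := hpos l (by omega)
        have h2 := hsgn (l + 1)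
        have : (-1 : ℚ) ^ (l + 1) * a' (l + 1)
            = ((-1) ^ (l + 1) * a (l + 1) + (-1) ^ l * a l) / (N + 1) := by
          simp only [a']
          ring
        rw [this]
        positivity
    · rintro (_ | l) hl
      · omega
      · simp [a', hzero l (by omega), hzero (l + 1) (by omega)]
    · intro x hx
      have hx1 : ∀ j : ℕ, x + 1 + j ≠ 0 := by
        intro j
        have := hx (j + 1)
        push_cast at this
        rwa [add_assoc, add_comm 1]
      have e1 := hpf x hx
      have e2 := hpf (x + 1) hx1
      have hshift : ∀ j : ℕ, x + ((j + 1 : ℕ) : ℚ) = x + 1 + j := by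
        intro j
        push_cast
        ring
      rw [Finset.prod_range_succ'] at e1
      rw [Finset.prod_range_succ] at e2
      rw [Finset.prod_range_succ, Finset.prod_range_succ', Finset.sum_range_succ']
      simp only [hshift, Nat.cast_zero, add_zero] at e1 e2 ⊢
      have e3 : ∑ j ∈ Finset.range (N + 1), a (j + 1) * (x + 1 + j)⁻¹
          = ∑ j ∈ Finset.range (N + 1), a j * (x + j)⁻¹ - a 0 * x⁻¹ := by
        have := Finset.sum_range_succ' (fun j => a j * (x + j)⁻¹) (N + 1)
        rw [Finset.sum_range_succ, hzero (N + 1) (by omega)] at this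
        simp only [hshift, Nat.cast_zero, add_zero, zero_mul] at this
        rw [this]
        ring
      have e4 : ∑ k ∈ Finset.range (N + 1), a' (k + 1) * (x + 1 + k)⁻¹
          = (∑ j ∈ Finset.range (N + 1), a (j + 1) * (x + 1 + j)⁻¹
            - ∑ j ∈ Finset.range (N + 1), a j * (x + 1 + j)⁻¹) / (N + 1) := by
        rw [← Finset.sum_sub_distrib, Finset.sum_div]
        refine Finset.sum_congr rfl fun j _ => ?_
        simp only [a']
        ring
      rw [e4, e3, ← e1, ← e2]
      have h0 : x ≠ 0 := by simpa using hx 0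
      have h1 := hx1 N
      rw [show a' 0 = a 0 / (N + 1) from rfl]
      field_simp
      ring

/-- The double product `1 / (x)_{N + 1} (x + u)_{w + 1}`. -/
def gammaQuot (u : ℤ) (N w : ℕ) (x : ℚ) : ℚ :=
  (∏ i ∈ Finset.range (N + 1), (x + i)⁻¹) * ∏ i ∈ Finset.range (w + 1), (x + u + i)⁻¹

/-- The poles of the two factors sit at `-i`, `i ≤ N`, and `-(u + j)`, `j ≤ w`. The hypotheses say
that these ranges meet, so there is a double pole; every double pole contributes to `y` with the
sign `(-1) ^ u`. -/
theorem exists_piSqSum_gammaQuot (u : ℤ) (N w : ℕ) (h₁ : u ≤ N) (h₂ : 0 ≤ u + w) :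
    ∃ y : ℚ, y ≠ 0 ∧ PiSqSum (fun m : ℕ => gammaQuot u N w (m + 1 / 2)) y := by
  obtain ⟨a, ha, -, hapf⟩ := exists_partialFractions N
  obtain ⟨b, hb, -, hbpf⟩ := exists_partialFractions w
  refine ⟨∑ i ∈ Finset.range (N + 1), ∑ j ∈ Finset.range (w + 1),
    a i * b j * (if (i : ℤ) = u + j then 1 / 2 else 0), ?_, ?_⟩
  · have hterm : ∀ i ∈ Finset.range (N + 1), ∀ j ∈ Finset.range (w + 1), (i : ℤ) = u + j →
        0 < (-1 : ℚ) ^ u * (a i * b j * (if (i : ℤ) = u + j then 1 / 2 else 0)) := by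
      intro i hi j hj hij
      have h1 := ha i (by simpa [Nat.lt_succ_iff] using hi)
      have h2 := hb j (by simpa [Nat.lt_succ_iff] using hj)
      have hu : u = i - j := by omega
      rw [if_pos hij, hu, zpow_sub₀ (by norm_num), zpow_natCast, zpow_natCast]
      have hj1 : ((-1 : ℚ) ^ j) * (-1) ^ j = 1 := by rw [← mul_pow]; simp
      have : (-1 : ℚ) ^ i / (-1) ^ j * (a i * b j * (1 / 2))
          = 1 / 2 * (((-1) ^ i * a i) * ((-1) ^ j * b j)) := by
        rw [div_eq_mul_inv, inv_eq_of_mul_eq_one_left hj1]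
        ring
      rw [this]
      positivity
    have hterm' : ∀ i ∈ Finset.range (N + 1), ∀ j ∈ Finset.range (w + 1),
        0 ≤ (-1 : ℚ) ^ u * (a i * b j * (if (i : ℤ) = u + j then 1 / 2 else 0)) := by
      intro i hi j hj
      by_cases hij : (i : ℤ) = u + j
      · exact (hterm i hi j hj hij).le
      · simp [hij]
    obtain ⟨i, j, hi, hj, hij⟩ : ∃ i j : ℕ, i < N + 1 ∧ j < w + 1 ∧ (i : ℤ) = u + j := by
      rcases le_total 0 u with h | h
      · exact ⟨u.toNat, 0, by omega, by omega, by omega⟩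
      · exact ⟨0, (-u).toNat, by omega, by omega, by omega⟩
    have hi' := Finset.mem_range.2 hi
    have hj' := Finset.mem_range.2 hj
    have hpos : 0 < ∑ i ∈ Finset.range (N + 1), ∑ j ∈ Finset.range (w + 1),
        (-1 : ℚ) ^ u * (a i * b j * (if (i : ℤ) = u + j then 1 / 2 else 0)) :=
      Finset.sum_pos' (fun i hi => Finset.sum_nonneg fun j hj => hterm' i hi j hj)
        ⟨i, hi', Finset.sum_pos' (fun j hj => hterm' i hi' j hj) ⟨j, hj', hterm i hi' j hj' hij⟩⟩
    simp only [← Finset.mul_sum] at hpos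
    exact (mul_ne_zero_iff.1 hpos.ne').2
  · have key : PiSqSum (fun m : ℕ => ∑ i ∈ Finset.range (N + 1), ∑ j ∈ Finset.range (w + 1),
        a i * b j * (((m : ℚ) + 1 / 2 + (i : ℤ))⁻¹ * ((m : ℚ) + 1 / 2 + (u + j : ℤ))⁻¹))
        (∑ i ∈ Finset.range (N + 1), ∑ j ∈ Finset.range (w + 1),
          a i * b j * (if (i : ℤ) = u + j then 1 / 2 else 0)) :=
      PiSqSum.sum _ fun i _ => PiSqSum.sum _ fun j _ =>
        (piSqSum_inv_mul_inv i (u + j)).const_mul (a i * b j)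
    convert key using 2 with m
    rw [gammaQuot, hapf, hbpf, Finset.sum_mul_sum]
    · refine Finset.sum_congr rfl fun i _ => Finset.sum_congr rfl fun j _ => ?_
      push_cast
      rw [← add_assoc]
      ring
    · intro j
      have := nat_add_half_add_int_ne_zero m (u + j)
      push_cast at this
      rwa [← add_assoc] at this
    · intro j
      exact_mod_cast nat_add_half_add_int_ne_zero m j

/-- Negative indices are needed because `HahnRec` is imposed on all of `ℤ` and each `hahnRaise`
reaches one place to the left. -/
theorem exists_int_antidifference (f : ℤ → ℚ) :
    ∃ S : ℤ → ℚ, (∀ n, S n - S (n - 1) = f n) ∧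
      ∀ n : ℕ, S n = ∑ i ∈ Finset.range n, f (i + 1) := by
  refine ⟨fun n => ∑ i ∈ Finset.range n.toNat, f (i + 1)
    - ∑ i ∈ Finset.range (-n).toNat, f (-i), fun n => ?_, fun n => by simp⟩
  rcases lt_or_ge 0 n with h | h
  · obtain ⟨m, rfl⟩ : ∃ m : ℕ, n = m + 1 := ⟨n.toNat - 1, by omega⟩
    have h1 : ((m : ℤ) + 1).toNat = m + 1 := by omega
    have h2 : ((m : ℤ) + 1 - 1).toNat = m := by omega
    have h3 : (-((m : ℤ) + 1)).toNat = 0 := by omega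
    have h4 : (-((m : ℤ) + 1 - 1)).toNat = 0 := by omega
    simp only [h1, h2, h3, h4, Finset.sum_range_succ, Finset.range_zero, Finset.sum_empty]
    ring
  · obtain ⟨m, rfl⟩ : ∃ m : ℕ, n = -m := ⟨(-n).toNat, by omega⟩
    have h1 : (-(m : ℤ)).toNat = 0 := by omega
    have h2 : (-(m : ℤ) - 1).toNat = 0 := by omega
    have h3 : (-(-(m : ℤ))).toNat = m := by omega
    have h4 : (-(-(m : ℤ) - 1)).toNat = m + 1 := by omega
    simp only [h1, h2, h3, h4, Finset.sum_range_succ, Finset.range_zero, Finset.sum_empty]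
    ring

theorem tendsto_natCast_mul_inv_add (c : ℝ) :
    Tendsto (fun m : ℕ => (m : ℝ) * (m + c)⁻¹) atTop (nhds 1) := by
  have h : Tendsto (fun m : ℕ => (1 + c * (m : ℝ)⁻¹)⁻¹) atTop (nhds 1) := by
    have := ((tendsto_inv_atTop_nhds_zero_nat (𝕜 := ℝ)).const_mul c).const_add 1
    rw [mul_zero, add_zero] at this
    simpa using this.inv₀ one_ne_zero
  refine h.congr' ?_
  filter_upwards [eventually_gt_atTop 0] with m hm
  have hm' : (m : ℝ) ≠ 0 := by positivity
  have : (m : ℝ) + c = m * (1 + c * (m : ℝ)⁻¹) := by field_simp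
  rw [this, mul_inv, ← mul_assoc, mul_inv_cancel₀ hm', one_mul]

theorem tendsto_gammaQuot_div_zpow (u : ℤ) (N w : ℕ) :
    Tendsto (fun m : ℕ => (gammaQuot u N w (m + 1 / 2) : ℝ) / (m : ℝ) ^ (-(N + w + 2) : ℤ))
      atTop (nhds 1) := by
  have h1 := tendsto_finsetProd (Finset.range (N + 1)) (fun i _ =>
    tendsto_natCast_mul_inv_add (1 / 2 + i))
  have h2 := tendsto_finsetProd (Finset.range (w + 1)) (fun i _ =>
    tendsto_natCast_mul_inv_add (1 / 2 + u + i))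
  have h := h1.mul h2
  simp only [Finset.prod_const_one, mul_one] at h
  refine h.congr fun m => ?_
  rw [zpow_neg, div_inv_eq_mul, show (N + w + 2 : ℤ) = ((N + 1 + (w + 1) : ℕ) : ℤ) by push_cast; ring,
    zpow_natCast, pow_add, Finset.prod_mul_distrib, Finset.prod_mul_distrib, gammaQuot]
  simp only [Finset.prod_const, Finset.card_range]
  push_cast
  simp only [add_assoc]
  ring

/-! ### The Hahn difference equation -/

/-- The difference equation of Hahn type, on the half-integers, that underlies the second
four-parameter family. -/
def HahnRec (u v w k : ℚ) (z : ℤ → ℚ) : Prop :=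
  ∀ n : ℤ, ((n : ℚ) - 1 / 2 + u + v) * ((n : ℚ) - 1 / 2 + u + w) * (z n - z (n - 1))
    - ((n : ℚ) - 3 / 2) * ((n : ℚ) - 3 / 2 + u) * (z (n - 1) - z (n - 2))
    = k * (k + u + v + w + 1) * z (n - 1)

/-- The inverse of the backward difference on solutions of the Hahn equation. -/
def hahnRaise (u v w k : ℚ) (z : ℤ → ℚ) (n : ℤ) : ℚ :=
  (((n : ℚ) + 1 / 2 + u + v) * ((n : ℚ) + 1 / 2 + u + w) * z n
    - ((n : ℚ) - 1 / 2) * ((n : ℚ) - 1 / 2 + u) * z (n - 1)) / (k * (k + u + v + w + 1))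

/-- The difference of the numerators is the Hahn equation for `(v + 1, w + 1, k - 1)` at `n + 1`,
with the two eigenvalues differing by `u + v + w + 2`. -/
theorem hahnRaise_sub {u v w k : ℚ} (hk : k * (k + u + v + w + 1) ≠ 0) {z : ℤ → ℚ}
    (hz : HahnRec u (v + 1) (w + 1) (k - 1) z) (n : ℤ) :
    hahnRaise u v w k z (n + 1) - hahnRaise u v w k z n = z n := by
  have h := hz (n + 1)
  rw [show n + 1 - 1 = n by ring, show n + 1 - 2 = n - 1 by ring] at h
  rw [hahnRaise, hahnRaise, ← sub_div, div_eq_iff hk, show n + 1 - 1 = n by ring]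
  push_cast at h ⊢
  linear_combination h

/-- As `z` is the difference of `hahnRaise z`, the definition of `hahnRaise` at `n - 1` is itself
the Hahn equation. -/
theorem hahnRec_hahnRaise {u v w k : ℚ} (hk : k * (k + u + v + w + 1) ≠ 0) {z : ℤ → ℚ}
    (hz : HahnRec u (v + 1) (w + 1) (k - 1) z) : HahnRec u v w k (hahnRaise u v w k z) := by
  intro n
  have h1 := hahnRaise_sub hk hz (n - 1)
  have h2 := hahnRaise_sub hk hz (n - 2)
  rw [show n - 1 + 1 = n by ring] at h1
  rw [show n - 2 + 1 = n - 1 by ring] at h2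
  rw [h1, h2, hahnRaise, mul_div_cancel₀ _ hk, show n - 1 - 1 = n - 2 by ring]
  push_cast
  ring

/-- In `gammaQuot x / gammaQuot (x - 1)` all but the end factors cancel, leaving `(x - 1) * (x - 1 +
u) / ((x + u + v) * (x + u + w))`. -/
theorem hahnRec_of_sub_eq_gammaQuot {u : ℤ} {v w N : ℕ} (hN : (N : ℤ) = u + v) {z : ℤ → ℚ}
    (hz : ∀ n, z n - z (n - 1) = gammaQuot u N w (n - 1 / 2)) : HahnRec u v w 0 z := by
  intro n
  have h2 := hz (n - 1)
  rw [show n - 1 - 1 = n - 2 by ring] at h2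
  rw [hz n, h2, zero_mul, zero_mul, sub_eq_zero]
  have hN' : (N : ℚ) = u + v := by exact_mod_cast hN
  have hne : ∀ i : ℤ, (n : ℚ) - 1 / 2 + i ≠ 0 := by
    intro i
    have := half_int_ne_zero (n - 1 + i)
    push_cast at this
    intro h
    apply this
    linarith
  have e : ∀ i : ℕ, ((n - 1 : ℤ) : ℚ) - 1 / 2 + ((i + 1 : ℕ) : ℚ) = (n : ℚ) - 1 / 2 + i := by
    intro i
    push_cast
    ring
  have e' : ∀ i : ℕ,
      ((n - 1 : ℤ) : ℚ) - 1 / 2 + u + ((i + 1 : ℕ) : ℚ) = (n : ℚ) - 1 / 2 + u + i := by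
    intro i
    push_cast
    ring
  have h3 := hne N
  have h4 := hne (u + w)
  have h5 := hne (-1)
  have h6 := hne (u - 1)
  push_cast at h3 h4 h5 h6
  rw [← add_assoc] at h4
  have h5' : (n : ℚ) - 3 / 2 ≠ 0 := by
    intro h
    apply h5
    linarith
  have h6' : (n : ℚ) - 3 / 2 + u ≠ 0 := by
    intro h
    apply h6
    linarith
  have h7 : ((n - 1 : ℤ) : ℚ) - 1 / 2 + (0 : ℕ) = n - 3 / 2 := by
    push_cast
    ring
  have h8 : ((n - 1 : ℤ) : ℚ) - 1 / 2 + u + (0 : ℕ) = n - 3 / 2 + u := by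
    push_cast
    ring
  rw [gammaQuot, gammaQuot, Finset.prod_range_succ, Finset.prod_range_succ,
    Finset.prod_range_succ' (fun i : ℕ => (((n - 1 : ℤ) : ℚ) - 1 / 2 + i)⁻¹),
    Finset.prod_range_succ' (fun i : ℕ => (((n - 1 : ℤ) : ℚ) - 1 / 2 + u + i)⁻¹)]
  simp only [e, e', h7, h8]
  rw [add_assoc ((n : ℚ) - 1 / 2) (u : ℚ) (v : ℚ), ← hN']
  generalize ∏ i ∈ Finset.range N, ((n : ℚ) - 1 / 2 + i)⁻¹ = p
  generalize ∏ i ∈ Finset.range w, ((n : ℚ) - 1 / 2 + u + i)⁻¹ = q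
  generalize (n : ℚ) - 1 / 2 + N = x at *
  generalize (n : ℚ) - 1 / 2 + u + w = y at *
  generalize (n : ℚ) - 3 / 2 + u = x' at *
  generalize (n : ℚ) - 3 / 2 = y' at *
  field_simp

theorem tendsto_mul_mul_of_tendsto_div_zpow {e : ℤ} (he : 0 ≤ e) {r : ℕ → ℝ} {d : ℝ}
    (h : Tendsto (fun n : ℕ => r n / (n : ℝ) ^ (-(e + 2))) atTop (nhds d)) (a b : ℝ) :
    Tendsto (fun n : ℕ => (n + a) * (n + b) * r n) atTop (nhds (if e = 0 then d else 0)) := by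
  have h1 : Tendsto (fun n : ℕ => (n : ℝ) ^ (-e)) atTop (nhds (if e = 0 then 1 else 0)) := by
    split_ifs with h0
    · simp [h0]
    · have := (tendsto_natCast_zpow_atTop (lt_of_le_of_ne he (Ne.symm h0))).inv_tendsto_atTop
      refine this.congr fun n => ?_
      simp
  have h2 : ∀ a : ℝ, Tendsto (fun n : ℕ => 1 + a * (n : ℝ)⁻¹) atTop (nhds 1) := by
    intro a
    simpa using ((tendsto_inv_atTop_nhds_zero_nat (𝕜 := ℝ)).const_mul a).const_add 1
  have h3 := ((h2 a).mul (h2 b)).mul (h.mul h1)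
  simp only [one_mul, mul_ite, mul_one, mul_zero] at h3
  refine h3.congr' ?_
  filter_upwards [eventually_gt_atTop 0] with n hn
  have hn' : (n : ℝ) ≠ 0 := by positivity
  have : (n : ℝ) ^ e ≠ 0 := zpow_ne_zero _ hn'
  rw [zpow_neg, zpow_neg, zpow_add₀ hn', zpow_ofNat]
  field_simp

/-- Rational solutions of the Hahn equation approximating `π ^ 2`. -/
theorem exists_hahnRec_tendsto (u : ℤ) (k : ℕ) : ∀ v w : ℕ, 0 ≤ u + v + k → 0 ≤ u + w + k →
    ∃ P Q : ℤ → ℚ, HahnRec u v w k P ∧ HahnRec u v w k Q ∧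
      (∃ c : ℝ, c ≠ 0 ∧ Tendsto (fun n : ℕ => (Q n : ℝ) / (n : ℝ) ^ (k : ℤ)) atTop (nhds c)) ∧
      ∃ c : ℝ, c ≠ 0 ∧ Tendsto (fun n : ℕ => ((P n : ℝ) - Real.pi ^ 2 * Q n)
        / (n : ℝ) ^ (-(k + u + v + w + 1) : ℤ)) atTop (nhds c) := by
  induction k with
  | zero =>
    intro v w hv hw
    obtain ⟨N, hN⟩ : ∃ N : ℕ, (N : ℤ) = u + v := ⟨(u + v).toNat, by omega⟩
    obtain ⟨y, hy, q, hq⟩ := exists_piSqSum_gammaQuot u N w (by omega) (by omega)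
    obtain ⟨S, hS, hS'⟩ := exists_int_antidifference (fun n => gammaQuot u N w (n - 1 / 2))
    have hy' : (y : ℝ) ≠ 0 := by exact_mod_cast hy
    have hhalf : ∀ n : ℕ, (((n : ℤ) + 1 : ℤ) : ℚ) - 1 / 2 = n + 1 / 2 := by
      intro n
      push_cast
      ring
    have hstep : ∀ n : ℕ, S (n + 1 : ℕ) - S n = gammaQuot u N w (n + 1 / 2) := by
      intro n
      rw [hS', hS', Finset.sum_range_succ, add_sub_cancel_left, hhalf]
    have hlim : Tendsto (fun n : ℕ => (S n : ℝ)) atTop (nhds (q + y * Real.pi ^ 2)) := by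
      refine hq.congr fun n => ?_
      simp only [hS', hhalf]
    refine ⟨fun n => (S n - q) / y, fun _ => 1, ?_, ?_, ⟨1, one_ne_zero, by simp⟩, ?_⟩
    · have h := hahnRec_of_sub_eq_gammaQuot (w := w) hN hS
      intro n
      have h1 := h n
      simp only [Nat.cast_zero] at h1 ⊢
      linear_combination h1 / y
    · intro n
      simp
    · have hp : (-(N + w + 1) : ℤ) ≠ 0 := by omega
      have h := tendsto_div_zpow_of_tendsto_sub_div hp
        (r := fun n : ℕ => (((S n - q) / y : ℚ) : ℝ) - Real.pi ^ 2 * ((1 : ℚ) : ℝ)) (c := 1 / y)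
        ?_ ?_
      -- The increments have order `n ^ (-(N + w + 2)) / y`; summation divides by the new exponent.
      · refine ⟨1 / y / ((-(N + w + 1) : ℤ) : ℝ), div_ne_zero (one_div_ne_zero hy') ?_, ?_⟩
        · exact_mod_cast hp
        · rwa [show -((0 : ℕ) + u + v + w + 1 : ℤ) = -(N + w + 1) by push_cast; omega]
      · intro _
        have h1 := ((hlim.sub_const (q : ℝ)).div_const (y : ℝ)).sub_const (Real.pi ^ 2)
        have h2 : ((q : ℝ) + y * Real.pi ^ 2 - q) / y - Real.pi ^ 2 = 0 := by
          field_simp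
          ring
        rw [h2] at h1
        refine h1.congr fun n => ?_
        push_cast
        ring
      · have h1 := (tendsto_gammaQuot_div_zpow u N w).div_const (y : ℝ)
        refine h1.congr fun n => ?_
        rw [← hstep, show (-(N + w + 1) - 1 : ℤ) = -(N + w + 2) by ring]
        push_cast
        ring
  | succ k ih =>
    intro v w hv hw
    obtain ⟨P, Q, hP, hQ, ⟨c, hc, hQc⟩, d, hd, hRd⟩ := ih (v + 1) (w + 1)
      (by push_cast at hv ⊢; omega) (by push_cast at hw ⊢; omega)
    have hs : 0 ≤ (k : ℤ) + u + v + w + 1 := by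
      push_cast at hv
      omega
    have hl : ((k + 1 : ℕ) : ℚ) * ((k + 1 : ℕ) + u + v + w + 1) ≠ 0 := by
      refine mul_ne_zero (by positivity) ?_
      have : ((k + 1 : ℕ) : ℤ) + u + v + w + 1 ≠ 0 := by
        push_cast
        omega
      exact_mod_cast this
    have hPQ : ∀ {z : ℤ → ℚ}, HahnRec u (v + 1 : ℕ) (w + 1 : ℕ) k z →
        HahnRec u (v + 1) (w + 1) ((k + 1 : ℕ) - 1) z := by
      intro z hz
      simpa using hz
    have hstep : ∀ {z : ℤ → ℚ}, HahnRec u (v + 1 : ℕ) (w + 1 : ℕ) k z → ∀ n : ℕ,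
        hahnRaise u v w (k + 1 : ℕ) z (n + 1 : ℕ) - hahnRaise u v w (k + 1 : ℕ) z n = z n := by
      intro z hz n
      exact_mod_cast hahnRaise_sub hl (hPQ hz) n
    refine ⟨hahnRaise u v w (k + 1 : ℕ) P, hahnRaise u v w (k + 1 : ℕ) Q,
      hahnRec_hahnRaise hl (hPQ hP), hahnRec_hahnRaise hl (hPQ hQ), ?_, ?_⟩
    · have hp : ((k + 1 : ℕ) : ℤ) ≠ 0 := by omega
      refine ⟨_, ?_, tendsto_div_zpow_of_tendsto_sub_div hp (c := c) (fun h => by omega) ?_⟩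
      · refine div_ne_zero hc ?_
        exact_mod_cast hp
      · refine hQc.congr fun n => ?_
        rw [show (((k + 1 : ℕ) : ℤ) - 1) = k by push_cast; ring, ← hstep hQ n]
        push_cast
        rfl
    · have hp : (-(((k + 1 : ℕ) : ℤ) + u + v + w + 1)) ≠ 0 := by
        push_cast
        omega
      refine ⟨_, ?_, tendsto_div_zpow_of_tendsto_sub_div hp (c := d) (fun _ => ?_) ?_⟩
      · refine div_ne_zero hd ?_
        exact_mod_cast hp
      -- The error for `hahnRaise` must tend to 0. In the borderline case `k + u + v + w + 1 = 0`
      -- its two products tend to `d` rather than 0, but the limits cancel in the difference.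
      · have hlim : ∀ a b : ℝ, Tendsto (fun n : ℕ => (n + a) * (n + b) *
            ((P n : ℝ) - Real.pi ^ 2 * Q n)) atTop
              (nhds (if (k : ℤ) + u + v + w + 1 = 0 then d else 0)) :=
          fun a b => tendsto_mul_mul_of_tendsto_div_zpow hs (hRd.congr fun n => by
            congr 2
            push_cast
            ring) a b
        refine (tendsto_add_atTop_iff_nat 1).1 ?_
        have h := (((tendsto_add_atTop_iff_nat 1).2 (hlim (1 / 2 + u + v) (1 / 2 + u + w))).sub
          (hlim (1 / 2) (1 / 2 + u))).div_const
            ((((k + 1 : ℕ) : ℚ) * ((k + 1 : ℕ) + u + v + w + 1) : ℚ) : ℝ)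
        rw [sub_self, zero_div] at h
        refine h.congr fun n => ?_
        rw [hahnRaise, hahnRaise, show ((n + 1 : ℕ) : ℤ) - 1 = n by push_cast; ring]
        push_cast
        ring
      · refine hRd.congr fun n => ?_
        rw [show (-(((k + 1 : ℕ) : ℤ) + u + v + w + 1) - 1)
          = (-(k + u + (v + 1 : ℕ) + (w + 1 : ℕ) + 1)) by push_cast; ring,
          ← hstep hP n, ← hstep hQ n]
        push_cast
        ring

/-! ### From the Hahn equation to the continued fraction -/

theorem secondA_eq_comp_firstA (u v w k : ℚ) :
    secondA u v w k = 4 * (firstA u v w k).comp (X - C (1 / 2)) := by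
  refine Polynomial.funext fun x => ?_
  simp only [secondA, firstA, eval_add, eval_mul, eval_pow, eval_X, eval_C, eval_comp, eval_sub,
    eval_ofNat]
  ring

theorem secondB_eq_comp_firstB (u v w : ℚ) :
    secondB u v w = 16 * (firstB u v w).comp (X - C (1 / 2)) := by
  refine Polynomial.funext fun x => ?_
  simp only [secondB, firstB, eval_add, eval_mul, eval_neg, eval_X, eval_C, eval_comp, eval_sub,
    eval_ofNat, eval_one]
  ring

/-- The factor relating solutions of the Hahn equation to those of the continued fraction. -/
def gammaFactor (u v w : ℚ) (n : ℕ) : ℚ :=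
  ∏ i ∈ Finset.range n, 4 * (((i : ℚ) + 1 / 2 + u + v) * ((i : ℚ) + 1 / 2 + u + w))

theorem gammaFactor_succ (u v w : ℚ) (n : ℕ) : gammaFactor u v w (n + 1)
    = gammaFactor u v w n * (4 * (((n : ℚ) + 1 / 2 + u + v) * ((n : ℚ) + 1 / 2 + u + w))) :=
  Finset.prod_range_succ _ _

theorem gammaFactor_ne_zero (u : ℤ) (v w : ℕ) (n : ℕ) : gammaFactor u v w n ≠ 0 := by
  refine Finset.prod_ne_zero_iff.2 fun i _ => mul_ne_zero (by norm_num) (mul_ne_zero ?_ ?_)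
  · have := nat_add_half_add_int_ne_zero i (u + v)
    push_cast at this
    rwa [← add_assoc] at this
  · have := nat_add_half_add_int_ne_zero i (u + w)
    push_cast at this
    rwa [← add_assoc] at this

/-- This is the Hahn equation at `n + 2` times `4 * gammaFactor (n + 1)`. -/
theorem HahnRec.recurrence {u v w k : ℚ} {z : ℤ → ℚ} (hz : HahnRec u v w k z) (n : ℕ) :
    gammaFactor u v w (n + 2) * z (n + 2 : ℕ)
      = (secondA u v w k).eval ((n + 2 : ℕ) : ℚ) * (gammaFactor u v w (n + 1) * z (n + 1 : ℕ))
        + (secondB u v w).eval ((n + 1 : ℕ) : ℚ) * (gammaFactor u v w n * z n) := by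
  have h := hz (n + 2 : ℕ)
  rw [show ((n + 2 : ℕ) : ℤ) - 1 = (n + 1 : ℕ) by push_cast; ring,
    show ((n + 2 : ℕ) : ℤ) - 2 = n by push_cast; ring] at h
  rw [gammaFactor_succ u v w (n + 1), gammaFactor_succ]
  simp only [secondA, secondB, eval_add, eval_mul, eval_pow, eval_neg, eval_X, eval_C, eval_sub,
    eval_ofNat, eval_one]
  push_cast at h ⊢
  linear_combination gammaFactor u v w n * 16 *
    (((n : ℚ) + 1 / 2 + u + v) * ((n : ℚ) + 1 / 2 + u + w)) * h

/-- All four factors are odd integers. -/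
theorem eval_secondB_ne_zero (u : ℤ) (v w n : ℕ) : (secondB u v w).eval (n : ℚ) ≠ 0 := by
  simp only [secondB, eval_add, eval_mul, eval_neg, eval_X, eval_C, eval_sub, eval_ofNat, eval_one]
  have key : ∀ m : ℤ, (2 * (n : ℚ) - 1 + 2 * m) ≠ 0 := by
    intro m h
    have : (2 * (n : ℤ) - 1 + 2 * m) = 0 := by exact_mod_cast h
    omega
  have h0 := key 0
  have h1 := key u
  have h2 := key (u + v)
  have h3 := key (u + w)
  push_cast at h0 h2 h3
  rw [mul_zero, add_zero] at h0
  rw [mul_add] at h2 h3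
  exact neg_ne_zero.2 (mul_ne_zero (mul_ne_zero (mul_ne_zero h0 h1) h2) h3)

theorem mainTheorem5 (u : ℤ) (v w k : ℕ) (hu : -(k : ℤ) - min (v : ℤ) (w : ℤ) ≤ u) :
    (secondA u v w k = 4 * (firstA u v w k).comp (X - C (1 / 2)) ∧
      secondB u v w = 16 * (firstB u v w).comp (X - C (1 / 2))) ∧
    Represents (secondA u v w k) (secondB u v w) (Real.pi ^ 2) ∧
    ∀ a b : ℕ → ℚ, IsContFracFor (secondA u v w k) (secondB u v w) (Real.pi ^ 2) a b →
      ∃ c : ℝ, c ≠ 0 ∧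
        Asymptotics.IsEquivalent atTop
          (fun n : ℕ => Real.pi ^ 2 -
            (((contFrac a b).nums n / (contFrac a b).dens n : ℚ) : ℝ))
          (fun n : ℕ => c / (n : ℝ) ^ (u + v + w + 2 * k + 1)) := by
  refine ⟨⟨secondA_eq_comp_firstA _ _ _ _, secondB_eq_comp_firstB _ _ _⟩, ?_⟩
  obtain ⟨P, Q, hP, hQ, ⟨c, hc, hQc⟩, d, hd, hRd⟩ :=
    exists_hahnRec_tendsto u k v w (by omega) (by omega)
  have hQ0 : ∀ᶠ n : ℕ in atTop, Q n ≠ 0 := by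
    filter_upwards [hQc.eventually_ne hc] with n hn h
    simp [h] at hn
  refine represents_and_isEquivalent (P := fun n => gammaFactor u v w n * P n)
    (Q := fun n => gammaFactor u v w n * Q n) (c := d / c) (by omega) (div_ne_zero hd hc)
    (eval_secondB_ne_zero u v w) hP.recurrence hQ.recurrence ?_ ?_
  · filter_upwards [hQ0] with n hn using mul_ne_zero (gammaFactor_ne_zero u v w n) hn
  -- `gammaFactor` cancels in the quotient, and the exponents `k + u + v + w + 1` and `k` add up.
  · refine (hRd.div hQc hc).congr' ?_
    filter_upwards [hQ0, eventually_gt_atTop 0] with n hq hn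
    have hn' : (n : ℝ) ≠ 0 := by positivity
    have h1 : (gammaFactor u v w n : ℝ) ≠ 0 := by exact_mod_cast gammaFactor_ne_zero u v w n
    have h2 : (Q n : ℝ) ≠ 0 := by exact_mod_cast hq
    have h3 : (n : ℝ) ^ (k : ℤ) ≠ 0 := zpow_ne_zero _ hn'
    have h4 : (n : ℝ) ^ ((k : ℤ) + u + v + w + 1) ≠ 0 := zpow_ne_zero _ hn'
    simp only [Pi.div_apply]
    rw [show u + (v : ℤ) + w + 2 * k + 1 = (k + u + v + w + 1) + k by ring, zpow_add₀ hn',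
      zpow_neg]
    push_cast
    field_simp
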